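/- Let $K\ge 1$ and, for $k=1,\dots,K$, let $b_k\ge 1$ be an integer, $\lambda_k>0$, and $F_k:[0,1]\to[0,1]$ a continuous nondecreasing function with $F_k(0)=0$, $F_k(1)=1$ that is continuously differentiable in $(0,1)$ except at an at most countable set of points (the one-sided derivative of $F_k$ at $0$ may be infinite). Put $\lambda=\sum_k\lambda_k$, $a_k=\lambda_k/\lambda$, $B=\sum_k b_k$. For $n\ge 1$ let provider $k$ have $b_kn$ contents with popularities $$p^{(n)}_{k,i}=F_k\Bigl(\frac{i}{b_kn}\Bigr)-F_k\Bigl(\frac{i-1}{b_kn}\Bigr),\qquad i=1,\dots,b_kn,$$ and let content $i$ of provider $k$ be requested at rate $\lambda_kp^{(n)}_{k,i}$; that is, successive requests are independent and each is for content $(k,i)$ with probability $a_kp^{(n)}_{k,i}$. All $K$ providers share one LRU cache that holds $C^{(n)}$ contents, where the $C^{(n)}$ are nonnegative integers with $C^{(n)}/n\to\beta$, and $$\beta<\sum_{k=1}^K b_k\,\bigl|\{x\in(0,1):F_k'(x)>0\}\bigr|,$$ where $|\cdot|$ is Lebesgue measure (so the condition is $\beta<B$ if every $F_k'$ is positive almost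 everywhere). Then there is exactly one $\tau_0\ge 0$ with $$\frac{\beta}{B}=1-\sum_{k=1}^K\frac{b_k}{B}\int_0^1e^{-a_kF_k'(x)\tau_0B/b_k}\,dx .$$ Moreover, for every $n\ge1$ the probability that the $(t+1)$-st request is a miss converges as $t\to\infty$ to a limit $m^{(n)}$ that does not depend on the initial content of the cache (the aggregate LRU miss probability), and $$\lim_{n\to\infty}m^{(n)}=\mu^{(s)}:=\sum_{k=1}^Ka_k\int_0^1F_k'(x)\,e^{-a_kF_k'(x)\tau_0B/b_k}\,dx .$$ -/

import Mathlib

open Filter Topology MeasureTheory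

noncomputable section

/-- A popularity CDF on `[0,1]`: continuous, nondecreasing, `F 0 = 0`, `F 1 = 1`, and continuously
differentiable in `(0,1)` except at the points of a countable (possibly empty) set. Nothing is
required of the one-sided derivatives at `0` and `1`, which may be infinite. -/
structure IsPopularityCDF (F : ℝ → ℝ) : Prop where
  continuousOn : ContinuousOn F (Set.Icc 0 1)
  monotoneOn : MonotoneOn F (Set.Icc 0 1)
  map_zero : F 0 = 0
  map_one : F 1 = 1
  piecewise_C1 : ∃ E : Set ℝ, E.Countable ∧
    (∀ x ∈ Set.Ioo (0 : ℝ) 1 \ E, DifferentiableAt ℝ F x) ∧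
    ContinuousOn (deriv F) (Set.Ioo (0 : ℝ) 1 \ E)

/-- Popularity of content `i` of a provider with `N` contents; `i : Fin N` counts from `0`,
so this is `F (i / N) - F ((i - 1) / N)` in the numbering `i = 1, …, N`. -/
def popularity (F : ℝ → ℝ) (N : ℕ) (i : Fin N) : ℝ :=
  F (((i : ℕ) + 1 : ℝ) / (N : ℝ)) - F (((i : ℕ) : ℝ) / (N : ℝ))

/-- The contents of all providers: provider `k` has `b k * n` of them. -/
abbrev Content {K : ℕ} (b : Fin K → ℕ) (n : ℕ) : Type := (k : Fin K) × Fin (b k * n)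

/-- Request rate of a content: `lam k` times its popularity among the contents of provider `k`. -/
def contentRate {K : ℕ} (F : Fin K → ℝ → ℝ) (b : Fin K → ℕ) (lam : Fin K → ℝ) (n : ℕ)
    (c : Content b n) : ℝ :=
  lam c.1 * popularity (F c.1) (b c.1 * n) c.2

/-- Probability that a request of the aggregate stream is for the content `c`. -/
def requestProb {K : ℕ} (F : Fin K → ℝ → ℝ) (b : Fin K → ℕ) (lam : Fin K → ℝ) (n : ℕ)
    (c : Content b n) : ℝ :=
  contentRate F b lam n c / ∑ j, lam j

/-- One step of LRU with capacity `C`. The cache is a list, most recently used content first: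
the requested content moves to (or enters at) the front, and the least recently used content is
evicted if the capacity is exceeded. -/
def lruUpdate {α : Type} [DecidableEq α] (C : ℕ) (s : List α) (x : α) : List α :=
  (x :: s.erase x).take C

/-- Cache after the requests `w` (in chronological order), started from the cache `s`. -/
def lruState {α : Type} [DecidableEq α] (C : ℕ) (s : List α) (w : List α) : List α :=
  w.foldl (lruUpdate C) s

/-- Probability that, after `t` requests, the next request is a miss, when the requests are
independent with common law `q` and the cache initially is `s`. -/
def lruMissProbAt {α : Type} [Fintype α] [DecidableEq α] (q : α → ℝ) (C : ℕ) (s : List α)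
    (t : ℕ) : ℝ :=
  ∑ w : Fin t → α, ∑ x : α,
    (∏ j, q (w j)) * q x * (if x ∈ lruState C s (List.ofFn w) then 0 else 1)

/-- `m` is the steady-state LRU miss probability for independent requests with law `q`: the limit,
from every admissible initial cache, of the probability that the next request is a miss. -/
def IsLRUMissProb {α : Type} [Fintype α] [DecidableEq α] (q : α → ℝ) (C : ℕ) (m : ℝ) : Prop :=
  ∀ s : List α, s.Nodup → s.length ≤ C →
    Tendsto (fun t => lruMissProbAt q C s t) atTop (𝓝 m)

/-- Fraction of the requests that go to provider `k`. -/
def rateShare {K : ℕ} (lam : Fin K → ℝ) (k : Fin K) : ℝ := lam k / ∑ j, lam j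

/-- `B`, the sum of all `b k`. -/
def totalSize {K : ℕ} (b : Fin K → ℕ) : ℝ := ∑ k, (b k : ℝ)

/-- `1 - ∑ k, (b k / B) ∫₀¹ exp (-a k * F k' x * τ * B / b k) dx`. -/
def sharedBeta {K : ℕ} (F : Fin K → ℝ → ℝ) (b : Fin K → ℕ) (lam : Fin K → ℝ) (τ : ℝ) : ℝ :=
  1 - ∑ k, (b k : ℝ) / totalSize b *
    ∫ x in (0 : ℝ)..1,
      Real.exp (-(rateShare lam k * deriv (F k) x * τ * totalSize b / (b k : ℝ)))

/-- `∑ k, a k ∫₀¹ F k' x * exp (-a k * F k' x * τ * B / b k) dx`. -/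
def sharedMu {K : ℕ} (F : Fin K → ℝ → ℝ) (b : Fin K → ℕ) (lam : Fin K → ℝ) (τ : ℝ) : ℝ :=
  ∑ k, rateShare lam k *
    ∫ x in (0 : ℝ)..1, deriv (F k) x *
      Real.exp (-(rateShare lam k * deriv (F k) x * τ * totalSize b / (b k : ℝ)))

end

/-! An LRU cache of capacity `C` holds the first `C` entries of the list of contents ordered by
latest request. For a look-back length `J`, compare a miss with a request for a content absent from
the latest `J` requests. If these contain at most `C` distinct contents, all of them are cached and
every miss is such a new request; if they contain at least `C`, everything cached is among them and
every such new request is a miss. So the stationary miss probability equals `newRequestProb q J` up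
to the probability that the distinct count lies on the wrong side of `C` (`limitMissProb_le`,
`le_limitMissProb`). It exists because older history only helps to fill the cache
(`antitone_seqExpect_missGiven`), while the initial cache matters only for contents not yet
requested.

Take `J = ⌊τ * B * n⌋₊`. The number of unseen contents has mean about `B * n * (1 - sharedBeta τ)`,
and its variance is at most the number `B * n` of contents, since the events "unseen" are negatively
correlated. By Chebyshev the distinct count is therefore `B * n * sharedBeta τ` up to `o(n)`. The
new-request probability tends to `sharedMu τ`. Both limits are dominated convergence for step
functions on `[0,1]`, using `(1 - u) ^ J ≈ exp (-u * J)` and the convergence of difference quotients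
to `F'`.

The function `sharedBeta` is continuous and strictly increasing from `0` to the bound imposed on `β
/ B`, which determines `τ₀`. A `τ` slightly above or below `τ₀` puts the distinct count on the
required side of `C` with a margin linear in `n`; continuity of `sharedMu` then closes the gap
between the two bounds. -/

/-! ### The recency list of a request sequence -/

section Recency

variable {α : Type} [DecidableEq α]

/-- The contents in order of recency after the requests `v` (latest request first), when the order
before these requests was `s`. -/
def recencyList (s v : List α) : List α :=
  v.foldr (fun x l => x :: l.erase x) s

/-- Erasing one entry moves later entries forward by at most one place, so the first `c` survivors
depend only on the first `c + 1` entries. -/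
theorem take_erase_take_succ (c : ℕ) (l : List α) (x : α) :
    ((l.take (c + 1)).erase x).take c = (l.erase x).take c := by
  induction l generalizing c with
  | nil => simp
  | cons y l ih =>
    by_cases h : y = x
    · subst h; simp
    · cases c with
      | zero => simp
      | succ c =>
        simp only [List.take_succ_cons]
        rw [List.erase_cons_tail (by simpa using h), List.erase_cons_tail (by simpa using h)]
        simp only [List.take_succ_cons]
        rw [ih]

theorem lruUpdate_take (C : ℕ) (l : List α) (x : α) :
    lruUpdate C (l.take C) x = (x :: l.erase x).take C := by
  cases C with
  | zero => simp [lruUpdate]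
  | succ c => simp [lruUpdate, take_erase_take_succ]

/-- Truncation commutes with moving to the front, so evictions may be postponed to the end. The
reversal is there because `v` has its latest request first. -/
theorem lruState_eq_take_recencyList (C : ℕ) (s v : List α) (hs : s.length ≤ C) :
    lruState C s v.reverse = (recencyList s v).take C := by
  unfold lruState recencyList
  rw [List.foldl_reverse]
  induction v with
  | nil => simp [List.take_of_length_le hs]
  | cons x v ih => rw [List.foldr_cons, ih, lruUpdate_take, List.foldr_cons]

theorem recencyList_append (s v u : List α) :
    recencyList s (v ++ u) = recencyList (recencyList s u) v := by
  simp [recencyList]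

theorem recencyList_nil_prefix (s v : List α) : recencyList [] v <+: recencyList s v := by
  induction v with
  | nil => exact List.nil_prefix
  | cons x v ih =>
    obtain ⟨r, hr⟩ := ih
    change x :: (recencyList [] v).erase x <+: x :: (recencyList s v).erase x
    rw [← hr, List.erase_append, List.prefix_cons_inj]
    split_ifs with h
    · exact List.prefix_append _ _
    · rw [List.erase_of_not_mem h]
      exact List.prefix_append _ _

theorem nodup_recencyList (v : List α) : (recencyList [] v).Nodup := by
  induction v with
  | nil => exact List.nodup_nil
  | cons x v ih =>
    exact List.nodup_cons.2 ⟨ih.not_mem_erase, ih.erase x⟩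

theorem mem_recencyList (v : List α) (y : α) : y ∈ recencyList [] v ↔ y ∈ v := by
  induction v with
  | nil => exact Iff.rfl
  | cons x v ih =>
    change y ∈ x :: (recencyList [] v).erase x ↔ _
    rw [List.mem_cons, (nodup_recencyList v).mem_erase_iff, ih, List.mem_cons]
    tauto

theorem length_recencyList (v : List α) : (recencyList [] v).length = v.toFinset.card := by
  rw [← List.toFinset_card_of_nodup (nodup_recencyList v)]
  congr 1
  ext y
  simp [mem_recencyList]

theorem take_recencyList_of_le_card {C : ℕ} (s : List α) {v : List α} (h : C ≤ v.toFinset.card) :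
    (recencyList s v).take C = (recencyList [] v).take C := by
  obtain ⟨r, hr⟩ := recencyList_nil_prefix s v
  rw [← hr, List.take_append_of_le_length (by rwa [length_recencyList])]

theorem take_recencyList_of_card_le {C : ℕ} {v : List α} (h : v.toFinset.card ≤ C) :
    (recencyList [] v).take C = recencyList [] v :=
  List.take_of_length_le (by rwa [length_recencyList])

theorem mem_take_recencyList_of_nil {C : ℕ} (s : List α) {v : List α} {x : α}
    (h : x ∈ (recencyList [] v).take C) : x ∈ (recencyList s v).take C :=
  ((recencyList_nil_prefix s v).take C).subset h

/-- The earlier order `s` only affects places behind the contents of `v`, so it is irrelevant for a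
content of `v`. -/
theorem mem_take_recencyList_nil {C : ℕ} {s v : List α} {x : α}
    (h : x ∈ (recencyList s v).take C) (hx : x ∈ v) : x ∈ (recencyList [] v).take C := by
  rcases le_total C v.toFinset.card with hC | hC
  · rwa [take_recencyList_of_le_card s hC] at h
  · rw [take_recencyList_of_card_le hC]
    exact (mem_recencyList v x).2 hx

end Recency

/-! ### Expectations over independent request sequences -/

section Expectation

variable {α : Type} [Fintype α]

/-- Expectation of `f` over lists of `t` independent requests with law `q`. -/
def seqExpect (q : α → ℝ) : ℕ → (List α → ℝ) → ℝ
  | 0, f => f []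
  | t + 1, f => ∑ x, q x * seqExpect q t (fun v => f (x :: v))

theorem sum_prod_mul_ofFn (q : α → ℝ) (t : ℕ) (f : List α → ℝ) :
    ∑ w : Fin t → α, (∏ j, q (w j)) * f (List.ofFn w) = seqExpect q t f := by
  induction t generalizing f with
  | zero => simp [seqExpect]
  | succ t ih =>
    rw [← (Fin.consEquiv (fun _ : Fin (t + 1) => α)).sum_comp, Fintype.sum_prod_type]
    simp only [seqExpect, ← ih, Finset.mul_sum]
    refine Finset.sum_congr rfl fun x _ => Finset.sum_congr rfl fun w _ => ?_
    simp [Fin.prod_univ_succ, List.ofFn_succ, Fin.consEquiv, mul_assoc]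

theorem seqExpect_mono {q : α → ℝ} (hq : ∀ x, 0 ≤ q x) (t : ℕ) {f g : List α → ℝ}
    (h : ∀ v, f v ≤ g v) : seqExpect q t f ≤ seqExpect q t g := by
  induction t generalizing f g with
  | zero => exact h []
  | succ t ih =>
    exact Finset.sum_le_sum fun x _ => mul_le_mul_of_nonneg_left (ih fun v => h _) (hq x)

theorem seqExpect_const {q : α → ℝ} (hq : ∑ x, q x = 1) (t : ℕ) (c : ℝ) :
    seqExpect q t (fun _ => c) = c := by
  induction t with
  | zero => rfl
  | succ t ih => simp only [seqExpect, ih, ← Finset.sum_mul, hq, one_mul]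

theorem seqExpect_add (q : α → ℝ) (t : ℕ) (f g : List α → ℝ) :
    seqExpect q t (fun v => f v + g v) = seqExpect q t f + seqExpect q t g := by
  induction t generalizing f g with
  | zero => rfl
  | succ t ih => simp only [seqExpect, ih, mul_add, Finset.sum_add_distrib]

theorem seqExpect_const_mul (q : α → ℝ) (t : ℕ) (c : ℝ) (f : List α → ℝ) :
    seqExpect q t (fun v => c * f v) = c * seqExpect q t f := by
  induction t generalizing f with
  | zero => rfl
  | succ t ih =>
    simp only [seqExpect, ih, Finset.mul_sum]
    exact Finset.sum_congr rfl fun x _ => by ring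

theorem seqExpect_sub (q : α → ℝ) (t : ℕ) (f g : List α → ℝ) :
    seqExpect q t (fun v => f v - g v) = seqExpect q t f - seqExpect q t g := by
  have := seqExpect_add q t f (fun v => -1 * g v)
  rw [seqExpect_const_mul] at this
  simpa [sub_eq_add_neg] using this

theorem seqExpect_sum {ι : Type} (q : α → ℝ) (t : ℕ) (s : Finset ι) (f : ι → List α → ℝ) :
    seqExpect q t (fun v => ∑ i ∈ s, f i v) = ∑ i ∈ s, seqExpect q t (f i) := by
  classical
  induction s using Finset.induction_on with
  | empty => simpa using seqExpect_const_mul q t 0 (fun _ => 0)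
  | insert i s hi ih => simp only [Finset.sum_insert hi, seqExpect_add, ih]

theorem seqExpect_append (q : α → ℝ) (s t : ℕ) (f : List α → ℝ) :
    seqExpect q (s + t) f = seqExpect q s (fun v => seqExpect q t (fun u => f (v ++ u))) := by
  induction s generalizing f with
  | zero => simp [seqExpect]
  | succ s ih =>
    rw [Nat.succ_add]
    simp only [seqExpect, ih, List.cons_append]

/-- Independent requests with a common law are exchangeable; this permits reading a sequence
backwards from the present. -/
theorem seqExpect_reverse (q : α → ℝ) (t : ℕ) (f : List α → ℝ) :
    seqExpect q t (fun v => f v.reverse) = seqExpect q t f := by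
  induction t generalizing f with
  | zero => rfl
  | succ t ih =>
    rw [seqExpect_append q t 1 f]
    simp only [seqExpect, List.reverse_cons]
    rw [seqExpect_sum]
    refine Finset.sum_congr rfl fun x _ => ?_
    rw [seqExpect_const_mul, ih fun v => f (v ++ [x])]

variable [DecidableEq α]

/-- Each request avoids `s` independently. Singletons give the mean of the unseen count, pairs its
second moment. -/
theorem seqExpect_forall_notMem {q : α → ℝ} (hq : ∑ x, q x = 1) (t : ℕ) (s : Finset α) :
    seqExpect q t (fun v => if ∀ x ∈ s, x ∉ v then 1 else 0) = (1 - ∑ x ∈ s, q x) ^ t := by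
  induction t with
  | zero => simp [seqExpect]
  | succ t ih =>
    have h : ∀ y, seqExpect q t (fun v => if ∀ x ∈ s, x ∉ y :: v then (1 : ℝ) else 0)
        = if y ∈ s then 0 else (1 - ∑ x ∈ s, q x) ^ t := by
      intro y
      split_ifs with hy
      · refine Eq.trans ?_ (seqExpect_const hq t 0)
        congr 1
        funext v
        rw [if_neg]
        exact fun hv => hv y hy List.mem_cons_self
      · rw [← ih]
        congr 1
        funext v
        congr 1
        simp only [List.mem_cons, not_or, eq_iff_iff]
        exact forall₂_congr fun x hx => and_iff_right (fun h => hy (h ▸ hx))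
    simp only [seqExpect, h, mul_ite, mul_zero]
    rw [pow_succ', ← hq, ← Finset.sum_compl_add_sum s q, add_sub_cancel_right, Finset.sum_mul]
    rw [Finset.sum_ite, Finset.sum_const_zero, zero_add]
    exact Finset.sum_congr (by ext; simp) fun _ _ => rfl

end Expectation

/-! ### Miss probabilities of LRU -/

section LRU

variable {α : Type} [Fintype α] {q : α → ℝ}

/-- Probability that the next request after `J` requests is for a content not requested so far. -/
def newRequestProb (q : α → ℝ) (J : ℕ) : ℝ := ∑ x, q x * (1 - q x) ^ J

theorem le_one_of_sum_eq_one (hq0 : ∀ x, 0 ≤ q x) (hq : ∑ x, q x = 1) (x : α) : q x ≤ 1 :=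
  hq ▸ Finset.single_le_sum (fun y _ => hq0 y) (Finset.mem_univ x)

theorem tendsto_newRequestProb (hq0 : ∀ x, 0 ≤ q x) (hq : ∑ x, q x = 1) :
    Tendsto (newRequestProb q) atTop (𝓝 0) := by
  rw [← Finset.sum_const_zero (s := (Finset.univ : Finset α))]
  refine tendsto_finsetSum _ fun x _ => ?_
  rcases (hq0 x).eq_or_lt with h | h
  · simp [← h]
  · simpa using (tendsto_pow_atTop_nhds_zero_of_lt_one
      (sub_nonneg.2 (le_one_of_sum_eq_one hq0 hq x)) (sub_lt_self 1 h)).const_mul (q x)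

variable [DecidableEq α]

/-- Conditional probability of a miss at the next request, given the previous requests `v` (latest
first) and the initial recency order `s`. -/
def missGiven (q : α → ℝ) (C : ℕ) (s v : List α) : ℝ :=
  ∑ x, q x * if x ∈ (recencyList s v).take C then 0 else 1

theorem lruMissProbAt_eq_seqExpect (C : ℕ) {s : List α} (hs : s.length ≤ C) (t : ℕ) :
    lruMissProbAt q C s t = seqExpect q t (missGiven q C s) := by
  rw [← seqExpect_reverse, ← sum_prod_mul_ofFn]
  unfold lruMissProbAt missGiven
  refine Finset.sum_congr rfl fun w _ => ?_
  rw [Finset.mul_sum]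
  refine Finset.sum_congr rfl fun x _ => ?_
  rw [← lruState_eq_take_recencyList C s _ hs, List.reverse_reverse, mul_assoc]

theorem seqExpect_notMem (hq : ∑ x, q x = 1) (t : ℕ) (x : α) :
    seqExpect q t (fun v => if x ∈ v then 0 else 1) = (1 - q x) ^ t := by
  have := seqExpect_forall_notMem hq t {x}
  simpa [ite_not] using this

theorem seqExpect_newRequest (hq : ∑ x, q x = 1) (t : ℕ) :
    seqExpect q t (fun v => ∑ x, q x * if x ∈ v then 0 else 1) = newRequestProb q t := by
  rw [seqExpect_sum]
  exact Finset.sum_congr rfl fun x _ => by rw [seqExpect_const_mul, seqExpect_notMem hq]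

theorem missGiven_nonneg (hq0 : ∀ x, 0 ≤ q x) (C : ℕ) (s v : List α) : 0 ≤ missGiven q C s v :=
  Finset.sum_nonneg fun x _ => mul_nonneg (hq0 x) (by split_ifs <;> norm_num)

theorem missGiven_le_one (hq0 : ∀ x, 0 ≤ q x) (hq : ∑ x, q x = 1) (C : ℕ) (s v : List α) :
    missGiven q C s v ≤ 1 := by
  rw [← hq]
  exact Finset.sum_le_sum fun x _ => mul_le_of_le_one_right (hq0 x) (by split_ifs <;> norm_num)

theorem missGiven_le_missGiven_nil (hq0 : ∀ x, 0 ≤ q x) (C : ℕ) (s v : List α) :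
    missGiven q C s v ≤ missGiven q C [] v := by
  refine Finset.sum_le_sum fun x _ => mul_le_mul_of_nonneg_left ?_ (hq0 x)
  by_cases h : x ∈ (recencyList [] v).take C
  · simp [h, mem_take_recencyList_of_nil s h]
  · simp only [h, if_false]
    split_ifs <;> norm_num

/-- The caches started from `s` and from the empty list can differ in their verdict only on contents
outside `v`. -/
theorem missGiven_nil_le (hq0 : ∀ x, 0 ≤ q x) (C : ℕ) (s v : List α) :
    missGiven q C [] v ≤ missGiven q C s v + ∑ x, q x * if x ∈ v then 0 else 1 := by
  unfold missGiven
  rw [← Finset.sum_add_distrib]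
  refine Finset.sum_le_sum fun x _ => ?_
  rw [← mul_add]
  refine mul_le_mul_of_nonneg_left ?_ (hq0 x)
  by_cases hv : x ∈ v
  · by_cases h : x ∈ (recencyList s v).take C
    · simp [h, hv, mem_take_recencyList_nil h hv]
    · simp only [h, hv, if_false, if_true]
      split_ifs <;> norm_num
  · simp only [hv, if_false]
    split_ifs <;> norm_num

theorem missGiven_nil_le_of_card (hq0 : ∀ x, 0 ≤ q x) (hq : ∑ x, q x = 1) (C : ℕ) (v : List α) :
    missGiven q C [] v ≤ (∑ x, q x * if x ∈ v then 0 else 1)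
      + if C < v.toFinset.card then 1 else 0 := by
  split_ifs with h
  · refine (missGiven_le_one hq0 hq C [] v).trans (le_add_of_nonneg_left ?_)
    exact Finset.sum_nonneg fun x _ => mul_nonneg (hq0 x) (by split_ifs <;> norm_num)
  · rw [missGiven, take_recencyList_of_card_le (not_lt.1 h)]
    simp [mem_recencyList]

theorem le_missGiven_of_card (hq0 : ∀ x, 0 ≤ q x) (hq : ∑ x, q x = 1) (C : ℕ) (s v : List α) :
    (∑ x, q x * if x ∈ v then 0 else 1) - (if v.toFinset.card < C then 1 else 0)
      ≤ missGiven q C s v := by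
  split_ifs with h
  · refine le_trans (sub_nonpos.2 ?_) (missGiven_nonneg hq0 C s v)
    refine le_trans (Finset.sum_le_sum fun x _ => ?_) hq.le
    exact mul_le_of_le_one_right (hq0 x) (by split_ifs <;> norm_num)
  · rw [missGiven, take_recencyList_of_le_card s (not_lt.1 h), sub_zero]
    refine Finset.sum_le_sum fun x _ => mul_le_mul_of_nonneg_left ?_ (hq0 x)
    by_cases hx : x ∈ (recencyList [] v).take C
    · simp [hx, (mem_recencyList v x).1 (List.mem_of_mem_take hx)]
    · simp only [hx, if_false]
      split_ifs <;> norm_num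

/-- The limiting miss probability: the infimum over `t` of the miss probabilities after `t`
requests when starting from the empty cache. -/
noncomputable def limitMissProb (q : α → ℝ) (C : ℕ) : ℝ :=
  ⨅ t, seqExpect q t (missGiven q C [])

/-- One more request in the distant past acts as a nonempty initial order, which can only add
contents to the cache. -/
theorem antitone_seqExpect_missGiven (hq0 : ∀ x, 0 ≤ q x) (hq : ∑ x, q x = 1) (C : ℕ) :
    Antitone fun t => seqExpect q t (missGiven q C []) := by
  refine antitone_nat_of_succ_le fun t => ?_
  rw [seqExpect_append q t 1]
  refine seqExpect_mono hq0 t fun v => ?_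
  rw [← seqExpect_const hq 1 (missGiven q C [] v)]
  refine seqExpect_mono hq0 1 fun u => ?_
  simp only [missGiven, recencyList_append]
  exact missGiven_le_missGiven_nil hq0 C (recencyList [] u) v

theorem bddBelow_seqExpect_missGiven (hq0 : ∀ x, 0 ≤ q x) (hq : ∑ x, q x = 1) (C : ℕ) :
    BddBelow (Set.range fun t => seqExpect q t (missGiven q C [])) := by
  refine ⟨0, ?_⟩
  rintro _ ⟨t, rfl⟩
  rw [← seqExpect_const hq t 0]
  exact seqExpect_mono hq0 t fun v => missGiven_nonneg hq0 C [] v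

theorem isLRUMissProb_limitMissProb (hq0 : ∀ x, 0 ≤ q x) (hq : ∑ x, q x = 1) (C : ℕ) :
    IsLRUMissProb q C (limitMissProb q C) := by
  intro s _ hs
  have hlim : Tendsto (fun t => seqExpect q t (missGiven q C [])) atTop
      (𝓝 (limitMissProb q C)) :=
    tendsto_atTop_ciInf (antitone_seqExpect_missGiven hq0 hq C)
      (bddBelow_seqExpect_missGiven hq0 hq C)
  simp only [lruMissProbAt_eq_seqExpect C hs]
  have hlow := hlim.sub (tendsto_newRequestProb hq0 hq)
  rw [sub_zero] at hlow
  refine tendsto_of_tendsto_of_tendsto_of_le_of_le hlow hlim (fun t => ?_) fun t =>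
    seqExpect_mono hq0 t (missGiven_le_missGiven_nil hq0 C s)
  simp only
  rw [sub_le_iff_le_add, ← seqExpect_newRequest hq, ← seqExpect_add]
  exact seqExpect_mono hq0 t (missGiven_nil_le hq0 C s)

theorem limitMissProb_le (hq0 : ∀ x, 0 ≤ q x) (hq : ∑ x, q x = 1) (C J : ℕ) :
    limitMissProb q C ≤ newRequestProb q J
      + seqExpect q J (fun v => if C < v.toFinset.card then 1 else 0) := by
  refine (ciInf_le (bddBelow_seqExpect_missGiven hq0 hq C) J).trans ?_
  rw [← seqExpect_newRequest hq, ← seqExpect_add]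
  exact seqExpect_mono hq0 J (missGiven_nil_le_of_card hq0 hq C)

theorem limitMissProb_le_one (hq0 : ∀ x, 0 ≤ q x) (hq : ∑ x, q x = 1) (C : ℕ) :
    limitMissProb q C ≤ 1 :=
  (ciInf_le (bddBelow_seqExpect_missGiven hq0 hq C) 0).trans (missGiven_le_one hq0 hq C [] [])

theorem le_limitMissProb (hq0 : ∀ x, 0 ≤ q x) (hq : ∑ x, q x = 1) (C J : ℕ) :
    newRequestProb q J - seqExpect q J (fun v => if v.toFinset.card < C then 1 else 0)
      ≤ limitMissProb q C := by
  refine le_ciInf fun t => ?_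
  -- Passing from `t` to `J + t` requests only lowers the miss probability and makes `J` latest
  -- requests available; the bound below holds for every older history `u`.
  refine le_trans ?_ (antitone_seqExpect_missGiven hq0 hq C (Nat.le_add_left t J))
  simp only
  rw [seqExpect_append, ← seqExpect_newRequest hq, ← seqExpect_sub]
  refine seqExpect_mono hq0 J fun v => ?_
  rw [← seqExpect_const hq t (_ - _)]
  refine seqExpect_mono hq0 t fun u => ?_
  simp only [missGiven, recencyList_append]
  exact le_missGiven_of_card hq0 hq C (recencyList [] u) v

/-! ### Concentration of the number of distinct requests -/

/-- Number of contents that do not occur in `v`. -/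
def unseenCount (v : List α) : ℝ := ∑ x : α, if x ∈ v then 0 else 1

theorem unseenCount_eq (v : List α) :
    unseenCount v = (Fintype.card α : ℝ) - (v.toFinset.card : ℝ) := by
  have h : unseenCount v = ((v.toFinsetᶜ).card : ℝ) := by
    rw [unseenCount, Finset.card_eq_sum_ones, Nat.cast_sum, Finset.sum_ite,
      Finset.sum_const_zero, zero_add]
    exact Finset.sum_congr (by ext; simp) fun _ _ => by simp
  rw [h, Finset.card_compl, Nat.cast_sub (Finset.card_le_univ _)]

theorem seqExpect_unseenCount (hq : ∑ x, q x = 1) (t : ℕ) :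
    seqExpect q t unseenCount = ∑ x, (1 - q x) ^ t := by
  unfold unseenCount
  rw [seqExpect_sum]
  exact Finset.sum_congr rfl fun x _ => seqExpect_notMem hq t x

/-- Negative correlation: `1 - q x - q y ≤ (1 - q x) * (1 - q y)`. The extra term is the diagonal,
where an indicator equals its square. -/
theorem seqExpect_unseen_pair_le (hq0 : ∀ x, 0 ≤ q x) (hq : ∑ x, q x = 1) (t : ℕ) (x y : α) :
    seqExpect q t (fun v => (if x ∈ v then 0 else 1) * if y ∈ v then 0 else 1)
      ≤ (1 - q x) ^ t * (1 - q y) ^ t + if x = y then (1 - q x) ^ t else 0 := by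
  have hx := sub_nonneg.2 (le_one_of_sum_eq_one hq0 hq x)
  have hy := sub_nonneg.2 (le_one_of_sum_eq_one hq0 hq y)
  split_ifs with h
  · subst h
    rw [show (fun v : List α => (if x ∈ v then (0 : ℝ) else 1) * if x ∈ v then 0 else 1)
      = fun v => if x ∈ v then 0 else 1 by funext v; split_ifs <;> simp, seqExpect_notMem hq]
    exact le_add_of_nonneg_left (by positivity)
  · have hpair := seqExpect_forall_notMem hq t {x, y}
    rw [Finset.sum_pair h] at hpair
    have hsum : q x + q y ≤ 1 := by
      rw [← Finset.sum_pair h, ← hq]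
      exact Finset.sum_le_univ_sum_of_nonneg hq0
    rw [show (fun v : List α => (if x ∈ v then (0 : ℝ) else 1) * if y ∈ v then 0 else 1)
      = fun v => if ∀ z ∈ ({x, y} : Finset α), z ∉ v then 1 else 0 by
        funext v; by_cases h1 : x ∈ v <;> by_cases h2 : y ∈ v <;> simp [h1, h2], hpair, add_zero,
      ← mul_pow]
    refine pow_le_pow_left₀ (by linarith) ?_ t
    nlinarith [mul_nonneg (hq0 x) (hq0 y)]

theorem seqExpect_sq_unseenCount_sub_le (hq0 : ∀ x, 0 ≤ q x) (hq : ∑ x, q x = 1) (t : ℕ) :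
    seqExpect q t (fun v => (unseenCount v - ∑ x, (1 - q x) ^ t) ^ 2) ≤ Fintype.card α := by
  set z := ∑ x, (1 - q x) ^ t with hz
  have hsq : seqExpect q t (fun v => unseenCount v * unseenCount v) ≤ z * z + z := by
    have h1 : (fun v : List α => unseenCount v * unseenCount v) = fun v => ∑ x, ∑ y,
        (if x ∈ v then (0 : ℝ) else 1) * if y ∈ v then 0 else 1 := by
      funext v
      rw [unseenCount, Finset.sum_mul_sum]
    rw [h1, seqExpect_sum]
    simp only [seqExpect_sum]
    refine (Finset.sum_le_sum fun x _ => Finset.sum_le_sum fun y _ =>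
      seqExpect_unseen_pair_le hq0 hq t x y).trans_eq ?_
    simp only [Finset.sum_add_distrib, Finset.sum_ite_eq, Finset.mem_univ, if_true]
    rw [← Finset.sum_mul_sum]
  have hzcard : z ≤ Fintype.card α := by
    rw [hz, Fintype.card_eq_sum_ones, Nat.cast_sum]
    refine Finset.sum_le_sum fun x _ => ?_
    rw [Nat.cast_one]
    exact pow_le_one₀ (sub_nonneg.2 (le_one_of_sum_eq_one hq0 hq x)) (sub_le_self _ (hq0 x))
  have hexp : (fun v : List α => (unseenCount v - z) ^ 2)
      = fun v => unseenCount v * unseenCount v + ((-2 * z) * unseenCount v + z * z) := by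
    funext v; ring
  rw [hexp, seqExpect_add, seqExpect_add, seqExpect_const_mul, seqExpect_const hq,
    seqExpect_unseenCount hq, ← hz]
  linarith

/-- Chebyshev's inequality. -/
theorem seqExpect_indicator_le (hq0 : ∀ x, 0 ≤ q x) (hq : ∑ x, q x = 1) (t : ℕ) {δ : ℝ}
    (hδ : 0 < δ) (p : List α → Prop) [DecidablePred p]
    (hp : ∀ v, p v → δ ≤ |unseenCount v - ∑ x, (1 - q x) ^ t|) :
    seqExpect q t (fun v => if p v then 1 else 0) ≤ Fintype.card α / δ ^ 2 := by
  rw [le_div_iff₀ (by positivity), mul_comm, ← seqExpect_const_mul]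
  refine le_trans (seqExpect_mono hq0 t fun v => ?_) (seqExpect_sq_unseenCount_sub_le hq0 hq t)
  split_ifs with h
  · rw [mul_one, ← sq_abs (_ - _)]
    exact pow_le_pow_left₀ hδ.le (hp v h) 2
  · rw [mul_zero]; positivity

end LRU

/-! ### Sums over grid cells as integrals -/

section Grid

/-- Increment of `F` over the `j`-th cell of the grid of mesh `1 / N`. -/
noncomputable def gridIncrement (F : ℝ → ℝ) (N j : ℕ) : ℝ :=
  F (((j : ℝ) + 1) / N) - F ((j : ℝ) / N)

theorem integral_comp_natFloor_mul (h : ℕ → ℝ) {N : ℕ} (hN : 0 < N) :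
    ∫ x in (0 : ℝ)..1, h ⌊x * N⌋₊ = (∑ j ∈ Finset.range N, h j) / N := by
  have hN' : (0 : ℝ) < N := Nat.cast_pos.2 hN
  have heq : ∀ j : ℕ, Set.EqOn (fun _ : ℝ => h j) (fun x : ℝ => h ⌊x * N⌋₊)
      (Set.uIoo ((j : ℝ) / N) (((j + 1 : ℕ) : ℝ) / N)) := by
    intro j x hx
    rw [Set.uIoo_of_le (by gcongr; simp), Set.mem_Ioo, div_lt_iff₀ hN', lt_div_iff₀ hN'] at hx
    have : ⌊x * N⌋₊ = j := by
      rw [Nat.floor_eq_iff ((Nat.cast_nonneg j).trans hx.1.le)]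
      exact ⟨hx.1.le, by exact_mod_cast hx.2⟩
    simp only [this]
  have hsum := intervalIntegral.sum_integral_adjacent_intervals (μ := volume)
    (f := fun x : ℝ => h ⌊x * N⌋₊) (a := fun j : ℕ => (j : ℝ) / N) (n := N)
    fun j _ => (intervalIntegrable_const (c := h j)).congr_uIoo (heq j)
  simp only [Nat.cast_zero, zero_div, div_self hN'.ne'] at hsum
  rw [← hsum, Finset.sum_div]
  refine Finset.sum_congr rfl fun j _ => ?_
  rw [← intervalIntegral.integral_congr_uIoo (heq j), intervalIntegral.integral_const, smul_eq_mul]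
  push_cast
  field_simp
  ring

/-- The cell contains `x`, so its increment splits at `x`; the two first-order errors add up to at
most `ε / 2` times the cell length. -/
theorem tendsto_mul_gridIncrement {F : ℝ → ℝ} {x : ℝ} (hx : 0 ≤ x) (hF : DifferentiableAt ℝ F x) :
    Tendsto (fun N : ℕ => (N : ℝ) * gridIncrement F N ⌊x * N⌋₊) atTop (𝓝 (deriv F x)) := by
  have hl : Tendsto (fun N : ℕ => (⌊x * N⌋₊ : ℝ) / N) atTop (𝓝 x) :=
    (tendsto_nat_floor_mul_div_atTop hx).comp tendsto_natCast_atTop_atTop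
  have hr : Tendsto (fun N : ℕ => ((⌊x * N⌋₊ : ℝ) + 1) / N) atTop (𝓝 x) := by
    simpa [add_div] using hl.add (tendsto_one_div_atTop_nhds_zero_nat (𝕜 := ℝ))
  rw [Metric.tendsto_nhds]
  intro ε hε
  have ho := (hasDerivAt_iff_isLittleO.1 hF.hasDerivAt).def (half_pos hε)
  filter_upwards [hl.eventually ho, hr.eventually ho, eventually_gt_atTop 0] with N h1 h2 hN
  have hN' : (0 : ℝ) < N := Nat.cast_pos.2 hN
  have hlx : (⌊x * N⌋₊ : ℝ) / N ≤ x :=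
    (div_le_iff₀ hN').2 (Nat.floor_le (by positivity))
  have hxr : x ≤ ((⌊x * N⌋₊ : ℝ) + 1) / N :=
    (le_div_iff₀ hN').2 (Nat.lt_floor_add_one _).le
  set l := (⌊x * N⌋₊ : ℝ) / N with hl_def
  set r := ((⌊x * N⌋₊ : ℝ) + 1) / N with hr_def
  have hrl : (N : ℝ) * (r - l) = 1 := by
    rw [hl_def, hr_def]; field_simp; ring
  rw [Real.norm_eq_abs, Real.norm_eq_abs, smul_eq_mul] at h1 h2
  rw [abs_of_nonpos (sub_nonpos.2 hlx)] at h1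
  rw [abs_of_nonneg (sub_nonneg.2 hxr)] at h2
  rw [Real.dist_eq, gridIncrement, ← hl_def, ← hr_def]
  have key : |(F r - F l) - (r - l) * deriv F x| ≤ ε / 2 * (r - l) := by
    rw [abs_le] at h1 h2 ⊢
    constructor <;> linarith [h1.1, h1.2, h2.1, h2.2]
  calc |N * (F r - F l) - deriv F x|
      = N * |(F r - F l) - (r - l) * deriv F x| := by
        rw [← abs_of_pos hN', ← abs_mul, abs_of_pos hN', mul_sub (N : ℝ) (F r - F l), ← mul_assoc,
          hrl, one_mul]
    _ ≤ N * (ε / 2 * (r - l)) := by gcongr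
    _ = ε / 2 := by rw [mul_left_comm, hrl, mul_one]
    _ < ε := half_lt_self hε

theorem tendsto_one_sub_pow_exp {u : ℕ → ℝ} {J : ℕ → ℕ} {y T : ℝ} (hu : ∀ᶠ n in atTop, u n ≤ 1)
    (h : Tendsto (fun n : ℕ => (n : ℝ) * u n) atTop (𝓝 y))
    (hJ : Tendsto (fun n : ℕ => (J n : ℝ) / n) atTop (𝓝 T)) :
    Tendsto (fun n => (1 - u n) ^ J n) atTop (𝓝 (Real.exp (-(y * T)))) := by
  have h1 : Tendsto (fun n : ℕ => (1 + -u n) ^ n) atTop (𝓝 (Real.exp (-y))) :=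
    Real.tendsto_one_add_pow_exp_of_tendsto (by simpa using h.neg)
  -- Writes `(1 - u) ^ J` as `((1 - u) ^ n) ^ (J / n)` with a real outer exponent.
  have h2 := h1.rpow hJ (Or.inl (Real.exp_ne_zero _))
  rw [← Real.exp_mul, neg_mul] at h2
  refine h2.congr' ?_
  filter_upwards [hu, eventually_gt_atTop 0] with n hn hn0
  have hn' : (n : ℝ) ≠ 0 := by positivity
  rw [← sub_eq_add_neg, ← Real.rpow_natCast, ← Real.rpow_mul (sub_nonneg.2 hn),
    mul_div_cancel₀ _ hn', Real.rpow_natCast]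

/-- Gives a constant dominating function for the new-request integrand even where `F'` is unbounded.
-/
theorem mul_one_sub_pow_le {u : ℝ} (h1 : u ≤ 1) {J : ℕ} (hJ : 0 < J) :
    u * (1 - u) ^ J ≤ 1 / J := by
  have hJ' : (0 : ℝ) < J := Nat.cast_pos.2 hJ
  rw [le_div_iff₀ hJ']
  have hpow : (1 - u) ^ J ≤ Real.exp (-(u * J)) := by
    rw [mul_comm, ← mul_neg, Real.exp_nat_mul]
    exact pow_le_pow_left₀ (sub_nonneg.2 h1) (Real.one_sub_le_exp_neg u) J
  have hexp : u * J ≤ Real.exp (u * J) := by linarith [Real.add_one_le_exp (u * J)]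
  calc u * (1 - u) ^ J * J = u * J * (1 - u) ^ J := by ring
    _ ≤ Real.exp (u * J) * Real.exp (-(u * J)) :=
        mul_le_mul hexp hpow (pow_nonneg (sub_nonneg.2 h1) J) (Real.exp_pos _).le
    _ = 1 := by rw [← Real.exp_add, add_neg_cancel, Real.exp_zero]

end Grid

/-! ### Popularity distributions -/

/-- Integral over `[0,1]` of `exp (-f * s)`, where `f` is the derivative of `F`. -/
noncomputable def derivLaplace (F : ℝ → ℝ) (s : ℝ) : ℝ :=
  ∫ x in (0 : ℝ)..1, Real.exp (-(deriv F x * s))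

/-- Integral over `[0,1]` of `f * exp (-f * s)`, where `f` is the derivative of `F`. -/
noncomputable def derivLaplaceWeighted (F : ℝ → ℝ) (s : ℝ) : ℝ :=
  ∫ x in (0 : ℝ)..1, deriv F x * Real.exp (-(deriv F x * s))

namespace IsPopularityCDF

variable {F : ℝ → ℝ}

theorem gridIncrement_nonneg (hF : IsPopularityCDF F) {N j : ℕ} (hj : j < N) :
    0 ≤ gridIncrement F N j := by
  have hN : (0 : ℝ) < N := Nat.cast_pos.2 (by omega)
  have hj' : (j : ℝ) + 1 ≤ N := by exact_mod_cast hj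
  refine sub_nonneg.2 (hF.monotoneOn ⟨by positivity, (div_le_one hN).2 (by linarith)⟩
    ⟨by positivity, (div_le_one hN).2 hj'⟩ (by gcongr; linarith))

theorem sum_gridIncrement (hF : IsPopularityCDF F) {N : ℕ} (hN : 0 < N) :
    ∑ j ∈ Finset.range N, gridIncrement F N j = 1 := by
  have h := Finset.sum_range_sub (fun j : ℕ => F ((j : ℝ) / N)) N
  have hN' : (N : ℝ) ≠ 0 := by positivity
  simpa [gridIncrement, hN', hF.map_zero, hF.map_one] using h

theorem gridIncrement_le_one (hF : IsPopularityCDF F) {N j : ℕ} (hj : j < N) :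
    gridIncrement F N j ≤ 1 := by
  rw [← hF.sum_gridIncrement (Nat.zero_lt_of_lt hj)]
  exact Finset.single_le_sum (fun i hi => hF.gridIncrement_nonneg (Finset.mem_range.1 hi))
    (Finset.mem_range.2 hj)

theorem deriv_nonneg (hF : IsPopularityCDF F) {x : ℝ} (hx : x ∈ Set.Ioo (0 : ℝ) 1) :
    0 ≤ deriv F x := by
  rw [← derivWithin_of_mem_nhds (Icc_mem_nhds hx.1 hx.2)]
  exact hF.monotoneOn.derivWithin_nonneg

theorem intervalIntegrable_deriv (hF : IsPopularityCDF F) :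
    IntervalIntegrable (deriv F) volume 0 1 :=
  MonotoneOn.intervalIntegrable_deriv (by rw [Set.uIcc_of_le zero_le_one]; exact hF.monotoneOn)

/-- A countable exceptional set leaves no room for a singular part of the continuous function `F`.
-/
theorem integral_deriv (hF : IsPopularityCDF F) : ∫ x in (0 : ℝ)..1, deriv F x = 1 := by
  obtain ⟨E, hE, hd, -⟩ := hF.piecewise_C1
  rw [integral_eq_of_hasDerivAt_off_countable_of_le F (deriv F) zero_le_one hE hF.continuousOn
    (fun x hx => (hd x hx).hasDerivAt) hF.intervalIntegrable_deriv, hF.map_zero, hF.map_one,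
    sub_zero]

theorem ae_mem_Ioo : ∀ᵐ x : ℝ, x ∈ Set.uIoc (0 : ℝ) 1 → x ∈ Set.Ioo (0 : ℝ) 1 := by
  filter_upwards [(Set.countable_singleton (1 : ℝ)).ae_notMem volume] with x hx h
  rw [Set.uIoc_of_le zero_le_one] at h
  exact ⟨h.1, lt_of_le_of_ne h.2 hx⟩

theorem ae_differentiableAt (hF : IsPopularityCDF F) :
    ∀ᵐ x : ℝ, x ∈ Set.uIoc (0 : ℝ) 1 → x ∈ Set.Ioo (0 : ℝ) 1 ∧ DifferentiableAt ℝ F x := by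
  obtain ⟨E, hE, hd, -⟩ := hF.piecewise_C1
  filter_upwards [ae_mem_Ioo, hE.ae_notMem volume] with x hx hxE h
  exact ⟨hx h, hd x ⟨hx h, hxE⟩⟩

theorem tendsto_natCast_mul_gridIncrement {b : ℕ} (hb : 0 < b) (a : ℝ) {x : ℝ} (hx : 0 ≤ x)
    (hF : DifferentiableAt ℝ F x) :
    Tendsto (fun n : ℕ => (n : ℝ) * (a * gridIncrement F (b * n) ⌊x * (b * n : ℕ)⌋₊)) atTop
      (𝓝 (a * deriv F x / b)) := by
  have hb' : (b : ℝ) ≠ 0 := by positivity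
  have h := (((tendsto_mul_gridIncrement hx hF).comp
    (tendsto_id.const_mul_atTop' hb)).const_mul a).div_const (b : ℝ)
  refine h.congr fun n => ?_
  simp only [Function.comp_apply, id]
  push_cast
  field_simp

theorem natFloor_mul_lt {x : ℝ} (hx : x ∈ Set.Ioo (0 : ℝ) 1) {N : ℕ} (hN : 0 < N) :
    ⌊x * N⌋₊ < N := by
  have hN' : (0 : ℝ) < N := Nat.cast_pos.2 hN
  rw [Nat.floor_lt (mul_nonneg hx.1.le hN'.le)]
  exact mul_lt_of_lt_one_left hN' hx.2

theorem tendsto_unseen (hF : IsPopularityCDF F) {b : ℕ} (hb : 0 < b) {a : ℝ} (ha0 : 0 ≤ a)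
    (ha1 : a ≤ 1) {J : ℕ → ℕ} {T : ℝ}
    (hJ : Tendsto (fun n : ℕ => (J n : ℝ) / n) atTop (𝓝 T)) :
    Tendsto (fun n : ℕ => (∑ i : Fin (b * n), (1 - a * popularity F (b * n) i) ^ J n) / n) atTop
      (𝓝 (b * derivLaplace F (a * T / b))) := by
  have hb' : (b : ℝ) ≠ 0 := by positivity
  have hlim : Tendsto (fun n : ℕ => ∫ x in (0 : ℝ)..1,
      (1 - a * gridIncrement F (b * n) ⌊x * (b * n : ℕ)⌋₊) ^ J n) atTop
      (𝓝 (derivLaplace F (a * T / b))) := by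
    refine intervalIntegral.tendsto_integral_filter_of_dominated_convergence (fun _ => 1)
      (Eventually.of_forall fun n => ?_) ?_ intervalIntegrable_const ?_
    · have : Measurable fun j : ℕ => (1 - a * gridIncrement F (b * n) j) ^ J n :=
        measurable_from_nat
      exact (this.comp (Nat.measurable_floor.comp (measurable_id.mul_const _))).aestronglyMeasurable
    · filter_upwards [eventually_gt_atTop 0] with n hn
      filter_upwards [ae_mem_Ioo] with x hx h
      have hj := natFloor_mul_lt (hx h) (Nat.mul_pos hb hn)
      have h0 := hF.gridIncrement_nonneg hj
      have h1 := hF.gridIncrement_le_one hj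
      have h2 := mul_le_one₀ ha1 h0 h1
      have h3 := mul_nonneg ha0 h0
      rw [Real.norm_eq_abs, abs_of_nonneg (pow_nonneg (by linarith) _)]
      exact pow_le_one₀ (by linarith) (by linarith)
    · filter_upwards [hF.ae_differentiableAt] with x hx h
      obtain ⟨hx1, hx2⟩ := hx h
      have := tendsto_one_sub_pow_exp ?_ (tendsto_natCast_mul_gridIncrement hb a hx1.1.le hx2) hJ
      · convert this using 4
        ring
      · filter_upwards [eventually_gt_atTop 0] with n hn
        have hj := natFloor_mul_lt hx1 (Nat.mul_pos hb hn)
        exact mul_le_one₀ ha1 (hF.gridIncrement_nonneg hj) (hF.gridIncrement_le_one hj)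
  refine (hlim.const_mul (b : ℝ)).congr' ?_
  filter_upwards [eventually_gt_atTop 0] with n hn
  have hn' : (n : ℝ) ≠ 0 := by positivity
  rw [integral_comp_natFloor_mul (fun j => (1 - a * gridIncrement F (b * n) j) ^ J n)
    (Nat.mul_pos hb hn), Finset.sum_range]
  push_cast
  rw [mul_div_mul_left _ _ hb' |>.symm]
  field_simp
  rfl

theorem tendsto_newRequest (hF : IsPopularityCDF F) {b : ℕ} (hb : 0 < b) {a : ℝ} (ha0 : 0 ≤ a)
    (ha1 : a ≤ 1) {J : ℕ → ℕ} {T : ℝ} (hT : 0 < T)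
    (hJ : Tendsto (fun n : ℕ => (J n : ℝ) / n) atTop (𝓝 T)) :
    Tendsto (fun n : ℕ => ∑ i : Fin (b * n),
      a * popularity F (b * n) i * (1 - a * popularity F (b * n) i) ^ J n) atTop
      (𝓝 (a * derivLaplaceWeighted F (a * T / b))) := by
  have hb' : (b : ℝ) ≠ 0 := by positivity
  have hlim : Tendsto (fun n : ℕ => ∫ x in (0 : ℝ)..1,
      (n : ℝ) * (a * gridIncrement F (b * n) ⌊x * (b * n : ℕ)⌋₊) *
        (1 - a * gridIncrement F (b * n) ⌊x * (b * n : ℕ)⌋₊) ^ J n) atTop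
      (𝓝 (∫ x in (0 : ℝ)..1,
        a * deriv F x / b * Real.exp (-(a * deriv F x / b * T)))) := by
    -- Eventually `J n > n * T / 2`, so the integrand is at most `n / J n ≤ 2 / T`.
    refine intervalIntegral.tendsto_integral_filter_of_dominated_convergence (fun _ => 2 / T)
      (Eventually.of_forall fun n => ?_) ?_ intervalIntegrable_const ?_
    · have : Measurable fun j : ℕ => (n : ℝ) * (a * gridIncrement F (b * n) j) *
          (1 - a * gridIncrement F (b * n) j) ^ J n := measurable_from_nat
      exact (this.comp (Nat.measurable_floor.comp (measurable_id.mul_const _))).aestronglyMeasurable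
    · filter_upwards [eventually_gt_atTop 0, hJ.eventually (lt_mem_nhds (half_lt_self hT))]
        with n hn hJn
      have hn' : (0 : ℝ) < n := Nat.cast_pos.2 hn
      rw [lt_div_iff₀ hn'] at hJn
      have hJ0 : (0 : ℝ) < J n := lt_trans (by positivity) hJn
      filter_upwards [ae_mem_Ioo] with x hx h
      have hj := natFloor_mul_lt (hx h) (Nat.mul_pos hb hn)
      have h0 := hF.gridIncrement_nonneg hj
      have h1 := hF.gridIncrement_le_one hj
      have h2 := mul_le_one₀ ha1 h0 h1
      have h3 := mul_nonneg ha0 h0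
      rw [Real.norm_eq_abs, abs_of_nonneg
        (mul_nonneg (mul_nonneg hn'.le h3) (pow_nonneg (by linarith) _)), mul_assoc]
      refine (mul_le_mul_of_nonneg_left (mul_one_sub_pow_le h2 (Nat.cast_pos.1 hJ0))
        hn'.le).trans ?_
      rw [mul_one_div, div_le_div_iff₀ hJ0 hT]
      linarith
    · filter_upwards [hF.ae_differentiableAt] with x hx h
      obtain ⟨hx1, hx2⟩ := hx h
      have h1 := tendsto_natCast_mul_gridIncrement hb a hx1.1.le hx2
      refine h1.mul (tendsto_one_sub_pow_exp ?_ h1 hJ)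
      filter_upwards [eventually_gt_atTop 0] with n hn
      have hj := natFloor_mul_lt hx1 (Nat.mul_pos hb hn)
      exact mul_le_one₀ ha1 (hF.gridIncrement_nonneg hj) (hF.gridIncrement_le_one hj)
  have heq : a * derivLaplaceWeighted F (a * T / b) = b * ∫ x in (0 : ℝ)..1,
      a * deriv F x / b * Real.exp (-(a * deriv F x / b * T)) := by
    rw [derivLaplaceWeighted, ← intervalIntegral.integral_const_mul,
      ← intervalIntegral.integral_const_mul]
    congr 1
    funext x
    rw [show deriv F x * (a * T / b) = a * deriv F x / b * T by ring]
    field_simp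
  rw [heq]
  refine (hlim.const_mul (b : ℝ)).congr' ?_
  filter_upwards [eventually_gt_atTop 0] with n hn
  have hn' : (n : ℝ) ≠ 0 := by positivity
  rw [integral_comp_natFloor_mul (fun j => (n : ℝ) * (a * gridIncrement F (b * n) j) *
    (1 - a * gridIncrement F (b * n) j) ^ J n) (Nat.mul_pos hb hn), Finset.sum_range]
  simp only [mul_assoc (n : ℝ)]
  rw [← Finset.mul_sum]
  push_cast
  field_simp
  rfl

/-! ### Laplace-type integrals of the derivative -/

theorem exp_neg_deriv_mul_le_one (hF : IsPopularityCDF F) {x s : ℝ}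
    (hx : x ∈ Set.Ioo (0 : ℝ) 1) (hs : 0 ≤ s) : Real.exp (-(deriv F x * s)) ≤ 1 :=
  Real.exp_le_one_iff.2 (neg_nonpos.2 (mul_nonneg (hF.deriv_nonneg hx) hs))

theorem measurable_exp_deriv (F : ℝ → ℝ) (s : ℝ) :
    Measurable fun x => Real.exp (-(deriv F x * s)) :=
  (((measurable_deriv F).mul_const s).neg).exp

theorem continuousOn_derivLaplace (hF : IsPopularityCDF F) :
    ContinuousOn (derivLaplace F) (Set.Ici 0) := by
  intro s _
  refine intervalIntegral.tendsto_integral_filter_of_dominated_convergence (fun _ => 1)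
    (Eventually.of_forall fun s => (measurable_exp_deriv F s).aestronglyMeasurable) ?_
    intervalIntegrable_const ?_
  · filter_upwards [self_mem_nhdsWithin] with s hs
    filter_upwards [ae_mem_Ioo] with x hx h
    rw [Real.norm_eq_abs, Real.abs_exp]
    exact hF.exp_neg_deriv_mul_le_one (hx h) hs
  · refine Eventually.of_forall fun x _ => Tendsto.mono_left ?_ nhdsWithin_le_nhds
    exact Continuous.tendsto (by fun_prop) s

theorem continuousOn_derivLaplaceWeighted (hF : IsPopularityCDF F) :
    ContinuousOn (derivLaplaceWeighted F) (Set.Ici 0) := by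
  intro s _
  refine intervalIntegral.tendsto_integral_filter_of_dominated_convergence (deriv F)
    (Eventually.of_forall fun s =>
      ((measurable_deriv F).mul (measurable_exp_deriv F s)).aestronglyMeasurable) ?_
    hF.intervalIntegrable_deriv ?_
  · filter_upwards [self_mem_nhdsWithin] with s hs
    filter_upwards [ae_mem_Ioo] with x hx h
    have h0 := hF.deriv_nonneg (hx h)
    rw [Real.norm_eq_abs, abs_of_nonneg (mul_nonneg h0 (Real.exp_pos _).le)]
    exact mul_le_of_le_one_right h0 (hF.exp_neg_deriv_mul_le_one (hx h) hs)
  · refine Eventually.of_forall fun x _ => Tendsto.mono_left ?_ nhdsWithin_le_nhds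
    exact Continuous.tendsto (by fun_prop) s

theorem derivLaplace_zero (F : ℝ → ℝ) : derivLaplace F 0 = 1 := by
  simp [derivLaplace]

theorem derivLaplaceWeighted_zero (hF : IsPopularityCDF F) : derivLaplaceWeighted F 0 = 1 := by
  simpa [derivLaplaceWeighted] using hF.integral_deriv

theorem intervalIntegrable_exp_deriv (hF : IsPopularityCDF F) {s : ℝ} (hs : 0 ≤ s) :
    IntervalIntegrable (fun x => Real.exp (-(deriv F x * s))) volume 0 1 := by
  refine (intervalIntegrable_const (c := (1 : ℝ))).mono_fun
    (measurable_exp_deriv F s).aestronglyMeasurable ?_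
  refine (ae_restrict_iff' measurableSet_uIoc).2 ?_
  filter_upwards [ae_mem_Ioo] with x hx h
  rw [Real.norm_eq_abs, Real.abs_exp, norm_one]
  exact hF.exp_neg_deriv_mul_le_one (hx h) hs

/-- Without strictness `F'` would vanish almost everywhere, although its integral is `1`. -/
theorem strictAntiOn_derivLaplace (hF : IsPopularityCDF F) :
    StrictAntiOn (derivLaplace F) (Set.Ici 0) := by
  intro s hs t ht hst
  refine intervalIntegral.integral_lt_integral_of_ae_le_of_measure_setOfPred_lt_ne_zero
    zero_le_one (hF.intervalIntegrable_exp_deriv ht) (hF.intervalIntegrable_exp_deriv hs) ?_ ?_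
  · refine (ae_restrict_iff' measurableSet_Ioc).2 ?_
    filter_upwards [ae_mem_Ioo] with x hx h
    rw [Set.uIoc_of_le zero_le_one] at hx
    exact Real.exp_le_exp.2 (neg_le_neg (mul_le_mul_of_nonneg_left hst.le
      (hF.deriv_nonneg (hx h))))
  · intro h0
    have hzero : ∫ x in (0 : ℝ)..1, deriv F x = 0 := by
      refine intervalIntegral.integral_zero_ae ?_
      have h0' : ∀ᵐ x ∂(volume.restrict (Set.Ioc (0 : ℝ) 1)),
          ¬ Real.exp (-(deriv F x * t)) < Real.exp (-(deriv F x * s)) := by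
        rw [ae_iff]
        simpa only [not_not] using h0
      rw [ae_restrict_iff' measurableSet_Ioc] at h0'
      filter_upwards [ae_mem_Ioo, h0'] with x hx hx0 h
      have h1 := hF.deriv_nonneg (hx h)
      rw [Set.uIoc_of_le zero_le_one] at h
      refine h1.antisymm' (not_lt.1 fun hpos => hx0 h ?_)
      exact Real.exp_lt_exp.2 (neg_lt_neg (mul_lt_mul_of_pos_left hst hpos))
    rw [hF.integral_deriv] at hzero
    exact one_ne_zero hzero

/-- The integrand tends to the indicator of `F' = 0`. This is the origin of the upper bound on `β`:
the part where `F' = 0` stays unseen for every `τ`. -/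
theorem tendsto_derivLaplace_atTop (hF : IsPopularityCDF F) :
    Tendsto (derivLaplace F) atTop (𝓝 (1 - (volume : Measure ℝ).real
      {x : ℝ | x ∈ Set.Ioo (0 : ℝ) 1 ∧ 0 < deriv F x})) := by
  have hms : MeasurableSet {x : ℝ | 0 < deriv F x} :=
    measurableSet_lt measurable_const (measurable_deriv F)
  have hval : ∫ x in (0 : ℝ)..1, (1 - {x : ℝ | 0 < deriv F x}.indicator 1 x : ℝ)
      = 1 - (volume : Measure ℝ).real {x : ℝ | x ∈ Set.Ioo (0 : ℝ) 1 ∧ 0 < deriv F x} := by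
    rw [intervalIntegral.integral_of_le zero_le_one, integral_Ioc_eq_integral_Ioo,
      integral_sub (integrable_const _) (IntegrableOn.integrable_indicator
        (f := (1 : ℝ → ℝ)) (integrable_const (1 : ℝ)).integrableOn hms),
      integral_indicator_one hms, measureReal_restrict_apply hms, Set.inter_comm]
    congr 1
    simp
  rw [← hval]
  refine intervalIntegral.tendsto_integral_filter_of_dominated_convergence (fun _ => 1)
    (Eventually.of_forall fun s => (measurable_exp_deriv F s).aestronglyMeasurable) ?_
    intervalIntegrable_const ?_
  · filter_upwards [eventually_ge_atTop 0] with s hs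
    filter_upwards [ae_mem_Ioo] with x hx h
    rw [Real.norm_eq_abs, Real.abs_exp]
    exact hF.exp_neg_deriv_mul_le_one (hx h) hs
  · filter_upwards [ae_mem_Ioo] with x hx h
    rcases (hF.deriv_nonneg (hx h)).eq_or_lt with h0 | h0
    · simp [← h0]
    · simp only [Set.indicator, Set.mem_ofPred_eq, h0, if_true, Pi.one_apply, sub_self]
      exact Real.tendsto_exp_neg_atTop_nhds_zero.comp (tendsto_id.const_mul_atTop h0)

end IsPopularityCDF

/-! ### The shared cache -/

section Shared

variable {K : ℕ} {F : Fin K → ℝ → ℝ} {b : Fin K → ℕ} {lam : Fin K → ℝ}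

theorem requestProb_eq (F : Fin K → ℝ → ℝ) (b : Fin K → ℕ) (lam : Fin K → ℝ) (n : ℕ)
    (c : Content b n) :
    requestProb F b lam n c = rateShare lam c.1 * popularity (F c.1) (b c.1 * n) c.2 :=
  mul_div_right_comm _ _ _

theorem rateShare_pos (hlam : ∀ k, 0 < lam k) (k : Fin K) : 0 < rateShare lam k :=
  div_pos (hlam k) (Finset.sum_pos (fun j _ => hlam j) ⟨k, Finset.mem_univ k⟩)

theorem sum_rateShare [NeZero K] (hlam : ∀ k, 0 < lam k) : ∑ k, rateShare lam k = 1 := by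
  unfold rateShare
  rw [← Finset.sum_div]
  exact div_self (Finset.sum_pos (fun j _ => hlam j) Finset.univ_nonempty).ne'

theorem rateShare_le_one (hlam : ∀ k, 0 < lam k) (k : Fin K) : rateShare lam k ≤ 1 :=
  div_le_one_of_le₀ (Finset.single_le_sum (fun j _ => (hlam j).le) (Finset.mem_univ k))
    (Finset.sum_nonneg fun j _ => (hlam j).le)

theorem totalSize_pos [NeZero K] (hb : ∀ k, 0 < b k) : 0 < totalSize b :=
  Finset.sum_pos (fun k _ => Nat.cast_pos.2 (hb k)) Finset.univ_nonempty

theorem requestProb_nonneg (hF : ∀ k, IsPopularityCDF (F k)) (hlam : ∀ k, 0 < lam k) (n : ℕ)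
    (c : Content b n) : 0 ≤ requestProb F b lam n c := by
  rw [requestProb_eq]
  exact mul_nonneg (rateShare_pos hlam c.1).le ((hF c.1).gridIncrement_nonneg c.2.2)

theorem sum_requestProb [NeZero K] (hF : ∀ k, IsPopularityCDF (F k)) (hb : ∀ k, 0 < b k)
    (hlam : ∀ k, 0 < lam k) {n : ℕ} (hn : 0 < n) : ∑ c, requestProb F b lam n c = 1 := by
  simp only [requestProb_eq, Fintype.sum_sigma, ← Finset.mul_sum]
  rw [← sum_rateShare hlam]
  refine Finset.sum_congr rfl fun k _ => ?_
  have h := (hF k).sum_gridIncrement (Nat.mul_pos (hb k) hn)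
  rw [Finset.sum_range] at h
  exact (congrArg (rateShare lam k * ·) h).trans (mul_one _)

theorem card_content (b : Fin K → ℕ) (n : ℕ) :
    (Fintype.card (Content b n) : ℝ) = totalSize b * n := by
  simp [totalSize, Finset.sum_mul]

theorem sharedBeta_eq (F : Fin K → ℝ → ℝ) (b : Fin K → ℕ) (lam : Fin K → ℝ) (τ : ℝ) :
    sharedBeta F b lam τ = 1 - ∑ k, (b k : ℝ) / totalSize b *
      derivLaplace (F k) (rateShare lam k * (τ * totalSize b) / b k) := by
  unfold sharedBeta derivLaplace
  congr! 7 with k _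
  ring

theorem sharedMu_eq (F : Fin K → ℝ → ℝ) (b : Fin K → ℕ) (lam : Fin K → ℝ) (τ : ℝ) :
    sharedMu F b lam τ = ∑ k, rateShare lam k *
      derivLaplaceWeighted (F k) (rateShare lam k * (τ * totalSize b) / b k) := by
  unfold sharedMu derivLaplaceWeighted
  refine Finset.sum_congr rfl fun k _ => ?_
  congr 2
  funext x
  congr 2
  ring

theorem laplaceArg_nonneg (hlam : ∀ k, 0 < lam k) {τ : ℝ} (hτ : 0 ≤ τ) (k : Fin K) :
    0 ≤ rateShare lam k * (τ * totalSize b) / b k := by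
  have := (rateShare_pos hlam k).le
  have : 0 ≤ totalSize b := Finset.sum_nonneg fun k _ => Nat.cast_nonneg _
  positivity

theorem continuousOn_sharedBeta (hF : ∀ k, IsPopularityCDF (F k)) (hlam : ∀ k, 0 < lam k) :
    ContinuousOn (sharedBeta F b lam) (Set.Ici 0) := by
  simp only [funext (sharedBeta_eq F b lam)]
  refine continuousOn_const.sub (continuousOn_finsetSum _ fun k _ => continuousOn_const.mul ?_)
  exact (hF k).continuousOn_derivLaplace.comp (by fun_prop) fun τ hτ => laplaceArg_nonneg hlam hτ k

theorem continuousOn_sharedMu (hF : ∀ k, IsPopularityCDF (F k)) (hlam : ∀ k, 0 < lam k) :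
    ContinuousOn (sharedMu F b lam) (Set.Ici 0) := by
  simp only [funext (sharedMu_eq F b lam)]
  refine continuousOn_finsetSum _ fun k _ => continuousOn_const.mul ?_
  exact (hF k).continuousOn_derivLaplaceWeighted.comp (by fun_prop)
    fun τ hτ => laplaceArg_nonneg hlam hτ k

theorem strictMonoOn_sharedBeta [NeZero K] (hF : ∀ k, IsPopularityCDF (F k)) (hb : ∀ k, 0 < b k)
    (hlam : ∀ k, 0 < lam k) : StrictMonoOn (sharedBeta F b lam) (Set.Ici 0) := by
  intro s hs t ht hst
  simp only [sharedBeta_eq]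
  refine sub_lt_sub_left (Finset.sum_lt_sum_of_nonempty Finset.univ_nonempty fun k _ => ?_) 1
  have hB := totalSize_pos hb
  have hbk : (0 : ℝ) < b k := Nat.cast_pos.2 (hb k)
  have ha := rateShare_pos hlam k
  refine mul_lt_mul_of_pos_left ((hF k).strictAntiOn_derivLaplace (laplaceArg_nonneg hlam hs k)
    (laplaceArg_nonneg hlam ht k) ?_) (div_pos hbk hB)
  gcongr

theorem sharedBeta_zero [NeZero K] (F : Fin K → ℝ → ℝ) (hb : ∀ k, 0 < b k) (lam : Fin K → ℝ) :
    sharedBeta F b lam 0 = 0 := by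
  rw [sharedBeta_eq]
  simp only [zero_mul, mul_zero, zero_div, IsPopularityCDF.derivLaplace_zero, mul_one]
  rw [← Finset.sum_div]
  exact sub_eq_zero.2 (div_self (totalSize_pos hb).ne').symm

theorem sharedMu_zero [NeZero K] (hF : ∀ k, IsPopularityCDF (F k)) (hlam : ∀ k, 0 < lam k) :
    sharedMu F b lam 0 = 1 := by
  rw [sharedMu_eq]
  simp only [zero_mul, mul_zero, zero_div, (hF _).derivLaplaceWeighted_zero, mul_one]
  exact sum_rateShare hlam

theorem tendsto_sharedBeta_atTop [NeZero K] (hF : ∀ k, IsPopularityCDF (F k)) (hb : ∀ k, 0 < b k)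
    (hlam : ∀ k, 0 < lam k) :
    Tendsto (sharedBeta F b lam) atTop (𝓝 ((∑ k, (b k : ℝ) * (volume : Measure ℝ).real
      {x : ℝ | x ∈ Set.Ioo (0 : ℝ) 1 ∧ 0 < deriv (F k) x}) / totalSize b)) := by
  have hB := totalSize_pos hb
  have hlim : Tendsto (sharedBeta F b lam) atTop (𝓝 (1 - ∑ k, (b k : ℝ) / totalSize b *
      (1 - (volume : Measure ℝ).real {x : ℝ | x ∈ Set.Ioo (0 : ℝ) 1 ∧ 0 < deriv (F k) x}))) := by
    simp only [funext (sharedBeta_eq F b lam)]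
    refine tendsto_const_nhds.sub (tendsto_finsetSum _ fun k _ => Tendsto.const_mul _ ?_)
    refine (hF k).tendsto_derivLaplace_atTop.comp ?_
    exact ((tendsto_id.atTop_mul_const hB).const_mul_atTop (rateShare_pos hlam k)).atTop_div_const
      (Nat.cast_pos.2 (hb k))
  convert hlim using 2
  simp only [mul_sub, mul_one, Finset.sum_sub_distrib, ← Finset.sum_div, div_mul_eq_mul_div]
  rw [show (∑ k, (b k : ℝ)) / totalSize b = 1 from div_self hB.ne']
  ring

theorem exists_sharedBeta_eq [NeZero K] (hF : ∀ k, IsPopularityCDF (F k)) (hb : ∀ k, 0 < b k)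
    (hlam : ∀ k, 0 < lam k) {β : ℝ} (hβ0 : 0 ≤ β)
    (hβ : β < ∑ k, (b k : ℝ) *
      (volume : Measure ℝ).real {x : ℝ | x ∈ Set.Ioo (0 : ℝ) 1 ∧ 0 < deriv (F k) x}) :
    ∃ τ, 0 ≤ τ ∧ β / totalSize b = sharedBeta F b lam τ := by
  have hB := totalSize_pos hb
  obtain ⟨T, hT, hT0⟩ := (((tendsto_sharedBeta_atTop hF hb hlam).eventually
    (lt_mem_nhds (div_lt_div_of_pos_right hβ hB))).and (eventually_ge_atTop 0)).exists
  obtain ⟨τ, hτ, h⟩ := intermediate_value_Icc hT0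
    ((continuousOn_sharedBeta hF hlam).mono Set.Icc_subset_Ici_self)
    ⟨(sharedBeta_zero F hb lam).trans_le (div_nonneg hβ0 hB.le), hT.le⟩
  exact ⟨τ, hτ.1, h.symm⟩

/-! ### Asymptotics for look-back lengths proportional to `n` -/

theorem tendsto_sum_unseen [NeZero K] (hF : ∀ k, IsPopularityCDF (F k)) (hb : ∀ k, 0 < b k)
    (hlam : ∀ k, 0 < lam k) {τ : ℝ} {J : ℕ → ℕ}
    (hJ : Tendsto (fun n : ℕ => (J n : ℝ) / n) atTop (𝓝 (τ * totalSize b))) :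
    Tendsto (fun n : ℕ => (∑ c, (1 - requestProb F b lam n c) ^ J n) / n) atTop
      (𝓝 (totalSize b * (1 - sharedBeta F b lam τ))) := by
  have hB := (totalSize_pos hb).ne'
  have heq : totalSize b * (1 - sharedBeta F b lam τ) = ∑ k, (b k : ℝ) *
      derivLaplace (F k) (rateShare lam k * (τ * totalSize b) / b k) := by
    rw [sharedBeta_eq, sub_sub_cancel, Finset.mul_sum]
    exact Finset.sum_congr rfl fun k _ => by field_simp
  simp only [requestProb_eq, Fintype.sum_sigma, Finset.sum_div _ _ (_ : ℝ)]
  rw [heq]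
  exact tendsto_finsetSum _ fun k _ => by
    simpa only [Finset.sum_div] using
      (hF k).tendsto_unseen (hb k) (rateShare_pos hlam k).le (rateShare_le_one hlam k) hJ

theorem tendsto_newRequestProb_requestProb [NeZero K] (hF : ∀ k, IsPopularityCDF (F k))
    (hb : ∀ k, 0 < b k) (hlam : ∀ k, 0 < lam k) {τ : ℝ} (hτ : 0 < τ) {J : ℕ → ℕ}
    (hJ : Tendsto (fun n : ℕ => (J n : ℝ) / n) atTop (𝓝 (τ * totalSize b))) :
    Tendsto (fun n : ℕ => newRequestProb (requestProb F b lam n) (J n)) atTop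
      (𝓝 (sharedMu F b lam τ)) := by
  simp only [newRequestProb, requestProb_eq, Fintype.sum_sigma]
  rw [sharedMu_eq]
  exact tendsto_finsetSum _ fun k _ => (hF k).tendsto_newRequest (hb k) (rateShare_pos hlam k).le
    (rateShare_le_one hlam k) (mul_pos hτ (totalSize_pos hb)) hJ

/-- A deviation of at least `g * n` against a variance of at most `B * n` has probability at most `B
/ (g ^ 2 * n)`. -/
theorem tendsto_seqExpect_indicator_zero [NeZero K] (hF : ∀ k, IsPopularityCDF (F k))
    (hb : ∀ k, 0 < b k) (hlam : ∀ k, 0 < lam k) (J : ℕ → ℕ) {g : ℝ} (hg : 0 < g)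
    (p : ∀ n, List (Content b n) → Prop) [∀ n, DecidablePred (p n)]
    (hp : ∀ᶠ n : ℕ in atTop, ∀ v, p n v →
      g * n ≤ |unseenCount v - ∑ c, (1 - requestProb F b lam n c) ^ J n|) :
    Tendsto (fun n => seqExpect (requestProb F b lam n) (J n) fun v => if p n v then 1 else 0)
      atTop (𝓝 0) := by
  have hlim : Tendsto (fun n : ℕ => totalSize b / g ^ 2 * (1 / (n : ℝ))) atTop (𝓝 0) := by
    simpa using (tendsto_one_div_atTop_nhds_zero_nat (𝕜 := ℝ)).const_mul (totalSize b / g ^ 2)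
  refine squeeze_zero' ?_ ?_ hlim
  · filter_upwards [eventually_gt_atTop 0] with n hn
    refine (seqExpect_const (sum_requestProb hF hb hlam hn) (J n) 0).symm.trans_le ?_
    exact seqExpect_mono (requestProb_nonneg hF hlam n) _ fun v => by split_ifs <;> norm_num
  · filter_upwards [eventually_gt_atTop 0, hp] with n hn hpn
    have hn' : (0 : ℝ) < n := Nat.cast_pos.2 hn
    refine (seqExpect_indicator_le (requestProb_nonneg hF hlam n) (sum_requestProb hF hb hlam hn)
      (J n) (mul_pos hg hn') (p n) hpn).trans_eq ?_
    rw [card_content]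
    field_simp

theorem tendsto_natFloor_div {T : ℝ} (hT : 0 ≤ T) :
    Tendsto (fun n : ℕ => (⌊T * n⌋₊ : ℝ) / n) atTop (𝓝 T) :=
  (tendsto_nat_floor_mul_div_atTop hT).comp tendsto_natCast_atTop_atTop

theorem eventually_lt_limitMissProb [NeZero K] (hF : ∀ k, IsPopularityCDF (F k))
    (hb : ∀ k, 0 < b k) (hlam : ∀ k, 0 < lam k) {β : ℝ} {C : ℕ → ℕ}
    (hC : Tendsto (fun n : ℕ => (C n : ℝ) / n) atTop (𝓝 β)) {τ : ℝ} (hτ : 0 < τ)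
    (hβ : β / totalSize b < sharedBeta F b lam τ) {y : ℝ} (hy : y < sharedMu F b lam τ) :
    ∀ᶠ n in atTop, y < limitMissProb (requestProb F b lam n) (C n) := by
  have hB := totalSize_pos hb
  have hJ := tendsto_natFloor_div (mul_pos hτ hB).le
  rw [div_lt_iff₀ hB] at hβ
  have hgap := (tendsto_sum_unseen hF hb hlam hJ).add hC
  -- The mean distinct count exceeds `C n` by about `(B * sharedBeta τ - β) * n`; half of this
  -- margin is kept for the deviation, the other half absorbs the errors in the limits.
  have hzero := tendsto_seqExpect_indicator_zero hF hb hlam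
    (fun n => ⌊τ * totalSize b * n⌋₊) (half_pos (sub_pos.2 hβ))
    (fun n v => v.toFinset.card < C n) (by
      filter_upwards [eventually_gt_atTop 0, hgap.eventually_lt_const
        (show _ < totalSize b - (sharedBeta F b lam τ * totalSize b - β) / 2 by linarith)]
        with n hn hgn v hv
      have hn' : (0 : ℝ) < n := Nat.cast_pos.2 hn
      rw [← add_div, div_lt_iff₀ hn'] at hgn
      have hv' : (v.toFinset.card : ℝ) < C n := by exact_mod_cast hv
      refine le_trans ?_ (le_abs_self _)
      rw [unseenCount_eq, card_content]
      linarith)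
  have hlim := (tendsto_newRequestProb_requestProb hF hb hlam hτ hJ).sub hzero
  rw [sub_zero] at hlim
  filter_upwards [hlim.eventually (lt_mem_nhds hy), eventually_gt_atTop 0] with n hn hn0
  exact hn.trans_le (le_limitMissProb (requestProb_nonneg hF hlam n)
    (sum_requestProb hF hb hlam hn0) _ _)

theorem eventually_limitMissProb_lt [NeZero K] (hF : ∀ k, IsPopularityCDF (F k))
    (hb : ∀ k, 0 < b k) (hlam : ∀ k, 0 < lam k) {β : ℝ} {C : ℕ → ℕ}
    (hC : Tendsto (fun n : ℕ => (C n : ℝ) / n) atTop (𝓝 β)) {τ : ℝ} (hτ : 0 < τ)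
    (hβ : sharedBeta F b lam τ < β / totalSize b) {y : ℝ} (hy : sharedMu F b lam τ < y) :
    ∀ᶠ n in atTop, limitMissProb (requestProb F b lam n) (C n) < y := by
  have hB := totalSize_pos hb
  have hJ := tendsto_natFloor_div (mul_pos hτ hB).le
  rw [lt_div_iff₀ hB] at hβ
  have hgap := (tendsto_sum_unseen hF hb hlam hJ).add hC
  have hzero := tendsto_seqExpect_indicator_zero hF hb hlam
    (fun n => ⌊τ * totalSize b * n⌋₊) (half_pos (sub_pos.2 hβ))
    (fun n v => C n < v.toFinset.card) (by
      filter_upwards [eventually_gt_atTop 0, hgap.eventually_const_lt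
        (show totalSize b + (β - sharedBeta F b lam τ * totalSize b) / 2 < _ by linarith)]
        with n hn hgn v hv
      have hn' : (0 : ℝ) < n := Nat.cast_pos.2 hn
      rw [← add_div, lt_div_iff₀ hn'] at hgn
      have hv' : (C n : ℝ) < v.toFinset.card := by exact_mod_cast hv
      refine le_trans ?_ (neg_le_abs _)
      rw [unseenCount_eq, card_content]
      linarith)
  have hlim := (tendsto_newRequestProb_requestProb hF hb hlam hτ hJ).add hzero
  rw [add_zero] at hlim
  filter_upwards [hlim.eventually (gt_mem_nhds hy), eventually_gt_atTop 0] with n hn hn0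
  exact (limitMissProb_le (requestProb_nonneg hF hlam n)
    (sum_requestProb hF hb hlam hn0) _ _).trans_lt hn

theorem tendsto_limitMissProb [NeZero K] (hF : ∀ k, IsPopularityCDF (F k))
    (hb : ∀ k, 0 < b k) (hlam : ∀ k, 0 < lam k) {β : ℝ} {C : ℕ → ℕ}
    (hC : Tendsto (fun n : ℕ => (C n : ℝ) / n) atTop (𝓝 β)) {τ₀ : ℝ} (hτ₀ : 0 ≤ τ₀)
    (hβ : β / totalSize b = sharedBeta F b lam τ₀) :
    Tendsto (fun n => limitMissProb (requestProb F b lam n) (C n)) atTop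
      (𝓝 (sharedMu F b lam τ₀)) := by
  have hmono := strictMonoOn_sharedBeta hF hb hlam
  have hcont : ContinuousWithinAt (sharedMu F b lam) (Set.Ici 0) τ₀ :=
    continuousOn_sharedMu hF hlam τ₀ hτ₀
  refine tendsto_order.2 ⟨fun y hy => ?_, fun y hy => ?_⟩
  · have hright := hcont.mono (Set.Ioi_subset_Ici hτ₀)
    obtain ⟨τ, hyτ, hτ⟩ := ((hright.eventually (lt_mem_nhds hy)).and self_mem_nhdsWithin).exists
    have hτ : τ₀ < τ := hτ
    exact eventually_lt_limitMissProb hF hb hlam hC (hτ₀.trans_lt hτ)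
      (hβ.trans_lt (hmono hτ₀ (hτ₀.trans hτ.le) hτ)) hyτ
  · rcases hτ₀.eq_or_lt with h0 | h0
    -- For `τ₀ = 0` there is no admissible `τ` to the left, but then `sharedMu` is `1` and the
    -- trivial bound suffices.
    · rw [← h0, sharedMu_zero hF hlam] at hy
      filter_upwards [eventually_gt_atTop 0] with n hn
      exact (limitMissProb_le_one (requestProb_nonneg hF hlam n)
        (sum_requestProb hF hb hlam hn) _).trans_lt hy
    · have hleft : Tendsto (sharedMu F b lam) (𝓝[<] τ₀) (𝓝 (sharedMu F b lam τ₀)) :=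
        (hcont.continuousAt (Ici_mem_nhds h0)).mono_left nhdsWithin_le_nhds
      obtain ⟨τ, hyτ, hτ⟩ := ((hleft.eventually (gt_mem_nhds hy)).and (Ioo_mem_nhdsLT h0)).exists
      exact eventually_limitMissProb_lt hF hb hlam hC hτ.1
        ((hmono hτ.1.le hτ₀ hτ.2).trans_eq hβ.symm) hyτ

end Shared

theorem theorem1 {K : ℕ} (F : Fin K → ℝ → ℝ) (hF : ∀ k, IsPopularityCDF (F k))
    (b : Fin K → ℕ) (hb : ∀ k, 0 < b k) (lam : Fin K → ℝ) (hlam : ∀ k, 0 < lam k)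
    (β : ℝ) (C : ℕ → ℕ)
    (hC : Tendsto (fun n : ℕ => (C n : ℝ) / (n : ℝ)) atTop (𝓝 β))
    (hβ : β < ∑ k, (b k : ℝ) *
      (volume : Measure ℝ).real {x : ℝ | x ∈ Set.Ioo (0 : ℝ) 1 ∧ 0 < deriv (F k) x}) :
    ∃ τ₀ : ℝ,
      (0 ≤ τ₀ ∧ β / totalSize b = sharedBeta F b lam τ₀) ∧
      (∀ τ : ℝ, 0 ≤ τ → β / totalSize b = sharedBeta F b lam τ → τ = τ₀) ∧
      ∃ m : ℕ → ℝ,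
        (∀ n : ℕ, 1 ≤ n → IsLRUMissProb (requestProb F b lam n) (C n) (m n)) ∧
        Tendsto m atTop (𝓝 (sharedMu F b lam τ₀)) := by
  have hβ0 : 0 ≤ β := ge_of_tendsto' hC fun n => by positivity
  -- For `K = 0` the sum in `hβ` is empty, which would force `β < 0`.
  have : NeZero K := ⟨by
    rintro rfl
    rw [Finset.univ_eq_empty, Finset.sum_empty] at hβ
    exact absurd hβ (not_lt.2 hβ0)⟩
  obtain ⟨τ₀, hτ₀, heq⟩ := exists_sharedBeta_eq hF hb hlam hβ0 hβ
  refine ⟨τ₀, ⟨hτ₀, heq⟩, fun τ hτ h => (strictMonoOn_sharedBeta hF hb hlam).injOn hτ hτ₀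
    (h.symm.trans heq), fun n => limitMissProb (requestProb F b lam n) (C n), fun n hn => ?_,
    tendsto_limitMissProb hF hb hlam hC hτ₀ heq⟩
  exact isLRUMissProb_limitMissProb (requestProb_nonneg hF hlam n)
    (sum_requestProb hF hb hlam hn) (C n)
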